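/- Let $d\in\mathbb{N}$ and let $n=1,2,\dots$ run through a finite or countably infinite set of dates ($1\le n\le T$ with $T\in\mathbb{N}\cup\{\infty\}$, $n<\infty$). For each $n$ let $X_n\subseteq\mathbb{R}^d$ be non-empty and closed, and let $\nu_n$ be a Borel probability measure on $X_n$ with $\int_{X_n}|x|\,d\nu_n(x)<\infty$. Equip $X=\prod_n X_n$ with the product topology, fix $s_0\in\mathbb{R}^d$, and put $S_0:=s_0$, $S_n(x):=x_n$ and $\mathcal{F}_n:=\sigma(S_j:j\le n)$. For Borel functions $g_n:X_n\to[0,\infty)$ let $\oplus g(x):=\sum_n g_n(x_n)\in[0,\infty]$, and write $\langle g_n,\nu_n\rangle=\int g_n\,d\nu_n$. Define - $G(\nu)$: the set of all $\oplus g$ with $\sum_n\langle g_n,\nu_n\rangle<\infty$; - $B(\nu)$: the set of Borel functions $f:X\to\mathbb{R}$ with $|f|\le\oplus g$ for some $\oplus g\in G(\nu)$; - $U(\nu)$: the set of upper semicontinuous functions $f:X\to\mathbb{R}$ with $f^+$ bounded and $f^-\in B(\nu)$. A semi-static strategy $(m,\oplus g,h)$ consists of $m\in\mathbb{R}$, $\oplus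 g\in G(\nu)$ and a finite sequence $h=(h_1,\dots,h_N)$ (with $N\in\mathbb{N}_0$, $N\le T$) of functions $h_n:X\to\mathbb{R}^d$ such that $h_n$ is $\mathcal{F}_{n-1}$-measurable. Its cost is $m+\sum_n\langle g_n,\nu_n\rangle$ and its outcome is $m+\oplus g+(h\cdot S)_N$, where $(h\cdot S)_N=\sum_{n=1}^N h_n\cdot(S_n-S_{n-1})$. It is a model-independent arbitrage if its cost is $\le 0$ and its outcome is $>0$ everywhere on $X$; it is a uniform arbitrage if its cost is $<0$ and its outcome is $\ge 0$ everywhere on $X$. For $f\in B(\nu)$ let $\phi(f)\in[-\infty,\infty]$ be the infimum of the costs of all semi-static strategies whose outcome is $\ge f$ everywhere on $X$. Let $\mathcal{M}(\nu)$ be the set of Borel probability measures $\mu$ on $X$ whose $n$-th marginal is $\nu_n$ for every $n$ and under which $(S_n)_{n\ge 0}$ is a $d$-dimensional martingale with respect to $(\mathcal{F}_n)_{n\ge0}$. Then the following are equivalent: (i) there is no model-independent arbitrage; (ii) there is no uniform arbitrage; (iii) $\mathcal{M}(\nu)\neq\emptyset$. Moreover, if (i)–(iii) hold, then for every $f\in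 B(\nu)\cap(U(\nu)+G(\nu))$, $f$ is integrable with respect to every $\mu\in\mathcal{M}(\nu)$ and $$\phi(f)=\max_{\mu\in\mathcal{M}(\nu)}\int f\,d\mu ,$$ the maximum being attained. -/

import Mathlib

open MeasureTheory ProbabilityTheory
open scoped NNReal ENNReal

noncomputable section

namespace MartTransport

/-- The space `ℝ^d` with its Euclidean norm. -/
abbrev Vec (d : ℕ) : Type := EuclideanSpace ℝ (Fin d)

/-- The trading dates `0, 1, 2, …` up to the horizon `T`, which is finite or `⊤`. -/
abbrev Time (T : ℕ∞) : Type := {n : ℕ // (n : ℕ∞) ≤ T}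

/-- The dates `1, 2, …` up to the horizon `T`; they index the (finite or countably infinite)
family of marginals. -/
abbrev Period (T : ℕ∞) : Type := {n : ℕ // 1 ≤ n ∧ (n : ℕ∞) ≤ T}

variable {d : ℕ} {T : ℕ∞}

/-- The path space `X = ∏ₙ Xₙ`. The product topology and the product `σ`-algebra (which is the
Borel `σ`-algebra, the product being countable) are the ones of a dependent function type. -/
abbrev PathSpace (X : Period T → Set (Vec d)) : Type := ∀ n : Period T, X n

/-- The discounted prices: `S₀ = s₀` and `Sₙ(x) = xₙ` for `n ≥ 1`. -/
def price (X : Period T → Set (Vec d)) (s₀ : Vec d) (t : Time T) (x : PathSpace X) : Vec d :=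
  if h : t.1 = 0 then s₀ else (x ⟨t.1, Nat.one_le_iff_ne_zero.mpr h, t.2⟩ : Vec d)

theorem measurable_price (X : Period T → Set (Vec d)) (s₀ : Vec d) (t : Time T) :
    Measurable (price X s₀ t) := by
  unfold price
  split_ifs with h
  · exact measurable_const
  · exact measurable_subtype_coe.comp (measurable_pi_apply _)

/-- The filtration `ℱₙ = σ(Sⱼ : j ≤ n)`. -/
def priceFiltration (X : Period T → Set (Vec d)) (s₀ : Vec d) :
    Filtration (Time T) (inferInstance : MeasurableSpace (PathSpace X)) :=
  Filtration.natural (price X s₀) fun t => (measurable_price X s₀ t).stronglyMeasurable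

/-- A static option portfolio: payoffs `gₙ : Xₙ → ℝ₊`, Borel measurable, with
`∑ₙ ⟨gₙ, νₙ⟩ < ∞`. -/
structure OptionPortfolio (X : Period T → Set (Vec d)) (ν : ∀ n, Measure (X n)) where
  /-- the option with maturity `n` -/
  g : ∀ n, X n → ℝ≥0
  measurable_g : ∀ n, Measurable (g n)
  price_lt_top : ∑' n, ∫⁻ y, (g n y : ℝ≥0∞) ∂(ν n) < ∞

/-- The payoff `⊕g = ∑ₙ gₙ ∘ πₙ`, with values in `[0, ∞]`. -/
def OptionPortfolio.payoff {X : Period T → Set (Vec d)} {ν : ∀ n, Measure (X n)}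
    (G : OptionPortfolio X ν) (x : PathSpace X) : ℝ≥0∞ :=
  ∑' n, (G.g n (x n) : ℝ≥0∞)

/-- The price `∑ₙ ⟨gₙ, νₙ⟩`, a finite number. -/
def OptionPortfolio.cost {X : Period T → Set (Vec d)} {ν : ∀ n, Measure (X n)}
    (G : OptionPortfolio X ν) : ℝ :=
  (∑' n, ∫⁻ y, (G.g n y : ℝ≥0∞) ∂(ν n)).toReal

/-- The dynamic trading strategies: finite sequences `h₁, …, h_N` of `ℝ^d`-valued functions on `X`,
where `hₙ` is `ℱₙ₋₁`-measurable. The field `h` is indexed from zero: `h n` stands for `hₙ₊₁`. -/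
structure DynamicStrategy (X : Period T → Set (Vec d)) (s₀ : Vec d) where
  /-- the number of trading periods used -/
  N : ℕ
  N_le : (N : ℕ∞) ≤ T
  /-- the holdings -/
  h : Fin N → PathSpace X → Vec d
  measurable_h : ∀ n : Fin N,
    Measurable[priceFiltration X s₀
      ⟨n, le_trans (Nat.cast_le.mpr (Nat.le_of_lt n.isLt)) N_le⟩] (h n)

/-- The gains `(h · S)_N = ∑ₙ hₙ · (Sₙ - Sₙ₋₁)`. -/
def DynamicStrategy.gains {X : Period T → Set (Vec d)} {s₀ : Vec d}
    (H : DynamicStrategy X s₀) (x : PathSpace X) : ℝ :=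
  ∑ n : Fin H.N, inner ℝ (H.h n x)
    (price X s₀ ⟨n + 1, le_trans (Nat.cast_le.mpr (Nat.succ_le_of_lt n.isLt)) H.N_le⟩ x
      - price X s₀ ⟨n, le_trans (Nat.cast_le.mpr (Nat.le_of_lt n.isLt)) H.N_le⟩ x)

/-- The set `Θ` of semi-static strategies `(m, ⊕g, h)`. -/
structure SemiStatic (X : Period T → Set (Vec d)) (ν : ∀ n, Measure (X n)) (s₀ : Vec d) where
  /-- the cash position -/
  m : ℝ
  /-- the static option position -/
  options : OptionPortfolio X ν
  /-- the dynamic trading -/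
  trading : DynamicStrategy X s₀

section

variable {X : Period T → Set (Vec d)} {ν : ∀ n, Measure (X n)} {s₀ : Vec d}

/-- The cost `m + ∑ₙ ⟨gₙ, νₙ⟩`. -/
def SemiStatic.cost (θ : SemiStatic X ν s₀) : ℝ := θ.m + θ.options.cost

/-- The outcome `m + ⊕g + (h · S)_N`, with values in `(-∞, ∞]`. -/
def SemiStatic.outcome (θ : SemiStatic X ν s₀) (x : PathSpace X) : EReal :=
  (θ.m : EReal) + (θ.options.payoff x : EReal) + (θ.trading.gains x : EReal)

def SemiStatic.IsModelIndependentArbitrage (θ : SemiStatic X ν s₀) : Prop :=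
  θ.cost ≤ 0 ∧ ∀ x, 0 < θ.outcome x

def SemiStatic.IsUniformArbitrage (θ : SemiStatic X ν s₀) : Prop :=
  θ.cost < 0 ∧ ∀ x, 0 ≤ θ.outcome x

end

/-- The superhedging functional: the infimum, in `[-∞, ∞]`, of the costs of all strategies whose
outcome dominates `f` pointwise. -/
def superhedgingPrice (X : Period T → Set (Vec d)) (ν : ∀ n, Measure (X n)) (s₀ : Vec d)
    (f : PathSpace X → ℝ) : EReal :=
  sInf {c : EReal | ∃ θ : SemiStatic X ν s₀,
    (∀ x, (f x : EReal) ≤ θ.outcome x) ∧ c = (θ.cost : EReal)}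

/-- `G(ν)`: the payoffs `⊕g` of static option portfolios. -/
def optionPayoffs (X : Period T → Set (Vec d)) (ν : ∀ n, Measure (X n)) :
    Set (PathSpace X → ℝ≥0∞) :=
  Set.range fun G : OptionPortfolio X ν => G.payoff

/-- `B(ν)`: Borel functions `f` with `|f| ≤ ⊕g` for some `⊕g ∈ G(ν)`. -/
def dominatedFunctions (X : Period T → Set (Vec d)) (ν : ∀ n, Measure (X n)) :
    Set (PathSpace X → ℝ) :=
  {f | Measurable f ∧ ∃ G ∈ optionPayoffs X ν, ∀ x, ENNReal.ofReal |f x| ≤ G x}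

/-- `U(ν)`: upper semicontinuous functions `f` with `f⁺` bounded and `f⁻ ∈ B(ν)`. -/
def uscFunctions (X : Period T → Set (Vec d)) (ν : ∀ n, Measure (X n)) :
    Set (PathSpace X → ℝ) :=
  {f | UpperSemicontinuous f ∧ (∃ C : ℝ, ∀ x, max (f x) 0 ≤ C) ∧
    (fun x => max (-f x) 0) ∈ dominatedFunctions X ν}

/-- The real-valued functions in `U(ν) + G(ν)`. -/
def uscAddOptions (X : Period T → Set (Vec d)) (ν : ∀ n, Measure (X n)) :
    Set (PathSpace X → ℝ) :=
  {f | ∃ u ∈ uscFunctions X ν, ∃ G ∈ optionPayoffs X ν,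
    ∀ x, (f x : EReal) = (u x : EReal) + (G x : EReal)}

/-- `𝒫(ν)`: the Borel probability measures on `X` with marginals `νₙ`. -/
def couplings (X : Period T → Set (Vec d)) (ν : ∀ n, Measure (X n)) :
    Set (Measure (PathSpace X)) :=
  {μ | IsProbabilityMeasure μ ∧ ∀ n, μ.map (fun x => x n) = ν n}

/-- `ℳ(ν)`: the measures in `𝒫(ν)` under which the price process, started at `s₀`, is a
`d`-dimensional martingale. -/
def martingaleMeasures (X : Period T → Set (Vec d)) (ν : ∀ n, Measure (X n)) (s₀ : Vec d) :
    Set (Measure (PathSpace X)) :=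
  {μ | μ ∈ couplings X ν ∧ Martingale (price X s₀) (priceFiltration X s₀) μ}

end MartTransport

end

/-! Under a martingale measure, option payoffs integrate to their cost and the gains of a strategy
contribute at most zero once they are bounded below by an integrable function. This yields weak
duality and excludes arbitrage. Holdings are arbitrary measurable functions, so the gains need not
be integrable a priori; the localization lemma `integrable_sum_of_localized` deals with that.

For the converse, absence of uniform arbitrage makes the superhedging price a finite sublinear
functional on the functions dominated by a constant plus an option payoff. Hahn–Banach
(`exists_linear_le_hedgeCosts`) gives a linear functional `L` below it, with equality at a chosen
`f`. Such an `L` is positive and normalized, prices bounded continuous options by their marginals,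
and is nonnegative on dominated gains.

To turn `L` into a measure, each `X n` is embedded in the closed unit ball and `L` is restricted to
continuous functions on the compact product of balls, where Riesz applies. The marginals of the
Riesz measure are the images of `ν n`, so by countability it is carried by the image of the path
space and pulls back to a coupling `μ` (`exists_coupling_of_positive_functional`).

Off these continuous functions `L` need not be integration against `μ`, but approximation from above
gives `L u ≤ ∫ u` for dominated upper semicontinuous `u` bounded above, and adding finite option
payoffs preserves the inequality. Applied to continuous one-step gains and their negatives it gives
the martingale property; applied to `f` it gives attainment. -/

open Filter Topology

noncomputable section

namespace MartTransport

/-! ### Sublinearity of the superhedging cost and Hahn–Banach. -/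

section Algebra

variable {d : ℕ} {T : ℕ∞} {X : Period T → Set (Vec d)} {ν : ∀ n, Measure (X n)} {s₀ : Vec d}

namespace OptionPortfolio

instance : Zero (OptionPortfolio X ν) :=
  ⟨⟨fun _ _ => 0, fun _ => measurable_const, by simp⟩⟩

instance : Add (OptionPortfolio X ν) :=
  ⟨fun G G' => ⟨fun n y => G.g n y + G'.g n y, fun n => (G.measurable_g n).add (G'.measurable_g n),
    by
      simp_rw [ENNReal.coe_add]
      simp_rw [lintegral_add_left (G.measurable_g _).coe_nnreal_ennreal]
      rw [ENNReal.tsum_add]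
      exact ENNReal.add_lt_top.mpr ⟨G.price_lt_top, G'.price_lt_top⟩⟩⟩

instance : SMul ℝ≥0 (OptionPortfolio X ν) :=
  ⟨fun c G => ⟨fun n y => c * G.g n y, fun n => (G.measurable_g n).const_mul c,
    by
      simp_rw [ENNReal.coe_mul]
      simp_rw [lintegral_const_mul _ (G.measurable_g _).coe_nnreal_ennreal]
      rw [ENNReal.tsum_mul_left]
      exact ENNReal.mul_lt_top (by simp) G.price_lt_top⟩⟩

theorem payoff_zero (x : PathSpace X) : (0 : OptionPortfolio X ν).payoff x = 0 := by
  change ∑' n : Period T, ((0 : ℝ≥0) : ℝ≥0∞) = 0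
  simp

theorem payoff_add (G G' : OptionPortfolio X ν) (x : PathSpace X) :
    (G + G').payoff x = G.payoff x + G'.payoff x := by
  change ∑' n, ((G.g n (x n) + G'.g n (x n) : ℝ≥0) : ℝ≥0∞) = _
  simp_rw [ENNReal.coe_add]
  exact ENNReal.tsum_add

theorem payoff_smul (c : ℝ≥0) (G : OptionPortfolio X ν) (x : PathSpace X) :
    (c • G).payoff x = c * G.payoff x := by
  change ∑' n, ((c * G.g n (x n) : ℝ≥0) : ℝ≥0∞) = _
  simp_rw [ENNReal.coe_mul]
  exact ENNReal.tsum_mul_left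

theorem cost_zero : (0 : OptionPortfolio X ν).cost = 0 := by
  change (∑' n : Period T, ∫⁻ y, ((0 : ℝ≥0) : ℝ≥0∞) ∂(ν n)).toReal = 0
  simp

theorem cost_add (G G' : OptionPortfolio X ν) : (G + G').cost = G.cost + G'.cost := by
  change (∑' n, ∫⁻ y, ((G.g n y + G'.g n y : ℝ≥0) : ℝ≥0∞) ∂(ν n)).toReal = _
  simp_rw [ENNReal.coe_add]
  simp_rw [lintegral_add_left (G.measurable_g _).coe_nnreal_ennreal]
  rw [ENNReal.tsum_add]
  exact ENNReal.toReal_add G.price_lt_top.ne G'.price_lt_top.ne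

theorem cost_smul (c : ℝ≥0) (G : OptionPortfolio X ν) : (c • G).cost = c * G.cost := by
  change (∑' n, ∫⁻ y, ((c * G.g n y : ℝ≥0) : ℝ≥0∞) ∂(ν n)).toReal = _
  simp_rw [ENNReal.coe_mul]
  simp_rw [lintegral_const_mul _ (G.measurable_g _).coe_nnreal_ennreal]
  rw [ENNReal.tsum_mul_left, ENNReal.toReal_mul]
  rfl

theorem measurable_payoff (G : OptionPortfolio X ν) : Measurable G.payoff :=
  Measurable.tsum fun n =>
    ((G.measurable_g n).comp (measurable_pi_apply n)).coe_nnreal_ennreal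

theorem single_apply (n : Period T) (g : X n → ℝ≥0) (k : Period T) (hk : k ≠ n) (y : X k) :
    (Pi.single n g : ∀ k, X k → ℝ≥0) k y = 0 := by
  rw [Pi.single_eq_of_ne hk]; rfl

/-- The portfolio consisting of a single option with maturity `n`. -/
def single (n : Period T) (g : X n → ℝ≥0) (hg : Measurable g)
    (hfin : ∫⁻ y, g y ∂(ν n) < ∞) : OptionPortfolio X ν where
  g := Pi.single n g
  measurable_g k := by
    rcases eq_or_ne k n with rfl | hk
    · simpa using hg
    · rw [Pi.single_eq_of_ne hk]; exact measurable_const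
  price_lt_top := by
    rw [tsum_eq_single n]
    · simpa using hfin
    · intro k hk
      simp [single_apply n g k hk]

theorem payoff_single (n : Period T) (g : X n → ℝ≥0) (hg : Measurable g)
    (hfin : ∫⁻ y, g y ∂(ν n) < ∞) (x : PathSpace X) :
    (single (ν := ν) n g hg hfin).payoff x = g (x n) := by
  change ∑' k, ((Pi.single n g : ∀ k, X k → ℝ≥0) k (x k) : ℝ≥0∞) = _
  rw [tsum_eq_single n]
  · simp
  · intro k hk
    simp [single_apply n g k hk]

theorem cost_single (n : Period T) (g : X n → ℝ≥0) (hg : Measurable g)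
    (hfin : ∫⁻ y, g y ∂(ν n) < ∞) :
    (single (ν := ν) n g hg hfin).cost = (∫⁻ y, g y ∂(ν n)).toReal := by
  change (∑' k, ∫⁻ y, ((Pi.single n g : ∀ k, X k → ℝ≥0) k y : ℝ≥0∞) ∂(ν k)).toReal = _
  rw [tsum_eq_single n]
  · simp
  · intro k hk
    simp [single_apply n g k hk]

end OptionPortfolio

/-- The functions which are the gains of some dynamic strategy. -/
def IsGain (X : Period T → Set (Vec d)) (s₀ : Vec d) (f : PathSpace X → ℝ) : Prop :=
  ∃ H : DynamicStrategy X s₀, H.gains = f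

theorem IsGain.zero : IsGain X s₀ 0 :=
  ⟨⟨0, by simp, fun n => n.elim0, fun n => n.elim0⟩, by ext x; simp [DynamicStrategy.gains]⟩

theorem IsGain.smul (c : ℝ) {f : PathSpace X → ℝ} (hf : IsGain X s₀ f) : IsGain X s₀ (c • f) := by
  obtain ⟨H, rfl⟩ := hf
  refine ⟨⟨H.N, H.N_le, fun n x => c • H.h n x, fun n => (H.measurable_h n).const_smul c⟩, ?_⟩
  ext x
  simp [DynamicStrategy.gains, inner_smul_left, Finset.mul_sum]

/-- Zero holdings at later dates earn nothing; this brings two strategies to a common length before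
they are added. -/
theorem DynamicStrategy.exists_pad (H : DynamicStrategy X s₀) (r : ℕ)
    (hr : ((H.N + r : ℕ) : ℕ∞) ≤ T) :
    ∃ H' : DynamicStrategy X s₀, H'.N = H.N + r ∧ H'.gains = H.gains := by
  obtain ⟨N, hN, h, hm⟩ := H
  refine ⟨⟨N + r, hr, fun n => if hn : n.1 < N then h ⟨n, hn⟩ else 0, fun n => ?_⟩, rfl, ?_⟩
  · split_ifs with hn
    · exact hm ⟨n, hn⟩
    · exact measurable_const
  · ext x
    simp [DynamicStrategy.gains, Fin.sum_univ_add]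

theorem IsGain.add_of_N_eq {N : ℕ} (H H' : DynamicStrategy X s₀) (h : H.N = N) (h' : H'.N = N) :
    IsGain X s₀ (H.gains + H'.gains) := by
  obtain ⟨N, hN, h, hm⟩ := H
  obtain ⟨N', hN', h', hm'⟩ := H'
  subst h
  subst h'
  refine ⟨⟨N', hN, fun n x => h n x + h' n x, fun n => (hm n).add (hm' n)⟩, ?_⟩
  ext x
  simp [DynamicStrategy.gains, inner_add_left, Finset.sum_add_distrib]

theorem IsGain.add {f f' : PathSpace X → ℝ} (hf : IsGain X s₀ f) (hf' : IsGain X s₀ f') :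
    IsGain X s₀ (f + f') := by
  obtain ⟨H, rfl⟩ := hf
  obtain ⟨H', rfl⟩ := hf'
  have key : ∀ H H' : DynamicStrategy X s₀, H.N ≤ H'.N → IsGain X s₀ (H.gains + H'.gains) := by
    intro H H' h
    obtain ⟨K, hK, hg⟩ := H.exists_pad (H'.N - H.N) (by
      rw [Nat.add_sub_cancel' h]; exact H'.N_le)
    rw [← hg]
    exact add_of_N_eq K H' (by omega) rfl
  rcases le_total H.N H'.N with h | h
  · exact key H H' h
  · rw [add_comm]; exact key H' H h

theorem IsGain.single (n : ℕ) (hn : ((n + 1 : ℕ) : ℕ∞) ≤ T) (h : PathSpace X → Vec d)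
    (hh : Measurable[priceFiltration X s₀
      ⟨n, le_trans (Nat.cast_le.mpr (Nat.le_succ n)) hn⟩] h) :
    IsGain X s₀ fun x => inner ℝ (h x) (price X s₀ ⟨n + 1, hn⟩ x
      - price X s₀ ⟨n, le_trans (Nat.cast_le.mpr (Nat.le_succ n)) hn⟩ x) := by
  refine ⟨⟨n + 1, hn, fun k => if k.1 = n then h else 0, fun k => ?_⟩, ?_⟩
  · split_ifs with hk
    · obtain ⟨k, hk'⟩ := k
      obtain rfl : k = n := hk
      exact hh
    · exact measurable_const
  · ext x
    have : ∀ i : Fin n, i.1 ≠ n := fun i => i.2.ne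
    simp [DynamicStrategy.gains, Fin.sum_univ_castSucc, this]

/-- Isolating the only possibly infinite term reduces superhedging to an inequality in `ℝ≥0∞`, with
no extended-real subtraction. -/
theorem real_le_outcome_iff (a m g : ℝ) (P : ℝ≥0∞) :
    (a : EReal) ≤ (m : EReal) + (P : EReal) + (g : EReal) ↔ ENNReal.ofReal (a - m - g) ≤ P := by
  induction P with
  | top => simp
  | coe p =>
    rw [ENNReal.ofReal_le_iff_le_toReal (by simp)]
    have : ((p : ℝ≥0∞) : EReal) = ((p : ℝ) : EReal) := rfl
    rw [this]
    norm_cast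
    simp only [ENNReal.coe_toReal]
    constructor <;> intro h <;> linarith

variable (X ν s₀) in
/-- The costs of the semi-static strategies which superhedge `f`. -/
def hedgeCosts (f : PathSpace X → ℝ) : Set ℝ :=
  {c | ∃ θ : SemiStatic X ν s₀, (∀ x, (f x : EReal) ≤ θ.outcome x) ∧ θ.cost = c}

theorem mem_hedgeCosts {f : PathSpace X → ℝ} {c : ℝ} :
    c ∈ hedgeCosts X ν s₀ f ↔ ∃ (m : ℝ) (G : OptionPortfolio X ν) (g : PathSpace X → ℝ),
      IsGain X s₀ g ∧ (∀ x, ENNReal.ofReal (f x - m - g x) ≤ G.payoff x) ∧ m + G.cost = c := by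
  constructor
  · rintro ⟨⟨m, G, H⟩, h, hc⟩
    exact ⟨m, G, H.gains, ⟨H, rfl⟩, fun x => (real_le_outcome_iff _ _ _ _).mp (h x), hc⟩
  · rintro ⟨m, G, _, ⟨H, rfl⟩, h, hc⟩
    exact ⟨⟨m, G, H⟩, fun x => (real_le_outcome_iff _ _ _ _).mpr (h x), hc⟩

theorem add_mem_hedgeCosts {f f' : PathSpace X → ℝ} {c c' : ℝ} (h : c ∈ hedgeCosts X ν s₀ f)
    (h' : c' ∈ hedgeCosts X ν s₀ f') : c + c' ∈ hedgeCosts X ν s₀ (f + f') := by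
  rw [mem_hedgeCosts] at *
  obtain ⟨m, G, g, hg, hf, rfl⟩ := h
  obtain ⟨m', G', g', hg', hf', rfl⟩ := h'
  refine ⟨m + m', G + G', g + g', hg.add hg', fun x => ?_, by rw [OptionPortfolio.cost_add]; ring⟩
  rw [OptionPortfolio.payoff_add]
  refine le_trans (le_of_eq_of_le ?_ ENNReal.ofReal_add_le) (add_le_add (hf x) (hf' x))
  simp only [Pi.add_apply]
  ring_nf

theorem smul_mem_hedgeCosts {f : PathSpace X → ℝ} {c : ℝ} (a : ℝ≥0)
    (h : c ∈ hedgeCosts X ν s₀ f) : a * c ∈ hedgeCosts X ν s₀ ((a : ℝ) • f) := by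
  rw [mem_hedgeCosts] at *
  obtain ⟨m, G, g, hg, hf, rfl⟩ := h
  refine ⟨a * m, a • G, (a : ℝ) • g, hg.smul _, fun x => ?_,
    by rw [OptionPortfolio.cost_smul]; ring⟩
  rw [OptionPortfolio.payoff_smul]
  have : ((a : ℝ) • f) x - a * m - ((a : ℝ) • g) x = a * (f x - m - g x) := by
    simp only [Pi.smul_apply, smul_eq_mul]; ring
  rw [this, ENNReal.ofReal_mul (NNReal.coe_nonneg a), ENNReal.ofReal_coe_nnreal]
  gcongr
  exact hf x

theorem mem_hedgeCosts_of_le {f : PathSpace X → ℝ} (m : ℝ) (G : OptionPortfolio X ν)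
    (h : ∀ x, ENNReal.ofReal (f x - m) ≤ G.payoff x) : m + G.cost ∈ hedgeCosts X ν s₀ f :=
  mem_hedgeCosts.mpr ⟨m, G, 0, .zero, by simpa using h, rfl⟩

theorem mem_hedgeCosts_of_gain {f : PathSpace X → ℝ} (hf : IsGain X s₀ f) :
    0 ∈ hedgeCosts X ν s₀ f :=
  mem_hedgeCosts.mpr ⟨0, 0, f, hf, by simp, by simp [OptionPortfolio.cost_zero]⟩

theorem nonneg_of_mem_hedgeCosts_zero
    (hna : ¬ ∃ θ : SemiStatic X ν s₀, θ.IsUniformArbitrage) {c : ℝ}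
    (hc : c ∈ hedgeCosts X ν s₀ 0) : 0 ≤ c := by
  obtain ⟨θ, h, rfl⟩ := hc
  by_contra! hlt
  exact hna ⟨θ, hlt, by simpa using h⟩

variable (X ν) in
/-- The vector space of functions dominated by a constant plus an option portfolio. -/
def dominatedSpace : Submodule ℝ (PathSpace X → ℝ) where
  carrier := {f | ∃ (M : ℝ≥0) (G : OptionPortfolio X ν), ∀ x, ‖f x‖ₑ ≤ M + G.payoff x}
  zero_mem' := ⟨0, 0, by simp⟩
  add_mem' := by
    rintro f f' ⟨M, G, h⟩ ⟨M', G', h'⟩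
    refine ⟨M + M', G + G', fun x => (enorm_add_le _ _).trans ((add_le_add (h x) (h' x)).trans ?_)⟩
    rw [OptionPortfolio.payoff_add, ENNReal.coe_add, add_add_add_comm]
  smul_mem' := by
    rintro c f ⟨M, G, h⟩
    refine ⟨‖c‖₊ * M, ‖c‖₊ • G, fun x => ?_⟩
    rw [OptionPortfolio.payoff_smul, Pi.smul_apply, enorm_smul, ENNReal.coe_mul, ← mul_add]
    exact mul_le_mul' le_rfl (h x)

theorem hedgeCosts_nonempty {f : PathSpace X → ℝ} (hf : f ∈ dominatedSpace X ν) :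
    (hedgeCosts X ν s₀ f).Nonempty := by
  obtain ⟨M, G, h⟩ := hf
  refine ⟨_, mem_hedgeCosts_of_le M G fun x => ?_⟩
  rw [ENNReal.ofReal_sub _ (NNReal.coe_nonneg M), ENNReal.ofReal_coe_nnreal, tsub_le_iff_left]
  exact Real.ofReal_le_enorm _ |>.trans (h x)

/-- A hedge of `f` plus a fixed hedge of `-f` is a hedge of `0`, whose cost cannot be negative
without uniform arbitrage. -/
theorem hedgeCosts_bddBelow (hna : ¬ ∃ θ : SemiStatic X ν s₀, θ.IsUniformArbitrage)
    {f : PathSpace X → ℝ} (hf : f ∈ dominatedSpace X ν) : BddBelow (hedgeCosts X ν s₀ f) := by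
  obtain ⟨b, hb⟩ := hedgeCosts_nonempty (s₀ := s₀) (neg_mem hf)
  refine ⟨-b, fun c hc => ?_⟩
  have := add_mem_hedgeCosts hc hb
  rw [add_neg_cancel] at this
  linarith [nonneg_of_mem_hedgeCosts_zero hna this]

/-- Hahn–Banach: the superhedging price dominates a linear functional which agrees with it
at a given function. -/
theorem exists_linear_le_hedgeCosts (hna : ¬ ∃ θ : SemiStatic X ν s₀, θ.IsUniformArbitrage)
    (f₀ : dominatedSpace X ν) :
    ∃ L : dominatedSpace X ν →ₗ[ℝ] ℝ, L f₀ = sInf (hedgeCosts X ν s₀ f₀) ∧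
      ∀ f : dominatedSpace X ν, ∀ c ∈ hedgeCosts X ν s₀ f, L f ≤ c := by
  set p : dominatedSpace X ν → ℝ := fun f => sInf (hedgeCosts X ν s₀ f)
  have hne := fun f : dominatedSpace X ν => hedgeCosts_nonempty (s₀ := s₀) f.2
  have hbd := fun f : dominatedSpace X ν => hedgeCosts_bddBelow hna f.2
  have hle : ∀ c : ℝ, 0 < c → ∀ f, p (c • f) ≤ c * p f := by
    intro c hc f
    rw [← div_le_iff₀' hc]
    refine le_csInf (hne f) fun b hb => ?_
    rw [div_le_iff₀' hc]
    exact csInf_le (hbd _) (smul_mem_hedgeCosts ⟨c, hc.le⟩ hb)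
  have hom : ∀ c : ℝ, 0 < c → ∀ f, p (c • f) = c * p f := by
    intro c hc f
    refine le_antisymm (hle c hc f) ?_
    have := hle c⁻¹ (inv_pos.mpr hc) (c • f)
    rw [inv_smul_smul₀ hc.ne'] at this
    rwa [← le_inv_mul_iff₀ hc]
  have hadd : ∀ f g, p (f + g) ≤ p f + p g := by
    intro f g
    rw [← sub_le_iff_le_add]
    refine le_csInf (hne f) fun b hb => ?_
    rw [sub_le_iff_le_add, ← sub_le_iff_le_add']
    refine le_csInf (hne g) fun b' hb' => ?_
    rw [sub_le_iff_le_add']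
    exact csInf_le (hbd _) (add_mem_hedgeCosts hb hb')
  have h0 : p 0 = 0 := by
    have := hom 2 two_pos 0
    rw [smul_zero] at this
    linarith
  have hneg : ∀ f, -p f ≤ p (-f) := by
    intro f
    have := hadd f (-f)
    rw [add_neg_cancel, h0] at this
    linarith
  -- Domination on the line through `f₀`, needed for the extension. Homogeneity covers only positive
  -- scalars; for negative ones subadditivity `-p f ≤ p (-f)` is used.
  have hline : ∀ c : ℝ, c * p f₀ ≤ p (c • f₀) := by
    intro c
    rcases lt_trichotomy c 0 with hc | rfl | hc
    · have h1 := hom (-c) (neg_pos.mpr hc) f₀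
      have h2 := hneg (-c • f₀)
      have h3 : -(-c • f₀) = c • f₀ := by ext; simp
      rw [h1, h3] at h2
      linarith
    · simp [h0]
    · exact (hom c hc f₀).ge
  obtain ⟨L, hL, hLp⟩ : ∃ L : dominatedSpace X ν →ₗ[ℝ] ℝ, L f₀ = p f₀ ∧ ∀ f, L f ≤ p f := by
    have hspan : ∀ c : ℝ, c • f₀ = 0 → c • p f₀ = 0 := by
      intro c hc
      rcases smul_eq_zero.mp hc with h | h
      · simp [h]
      · simp [h, h0]
    obtain ⟨L, h1, h2⟩ := exists_extension_of_le_sublinear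
      (LinearPMap.mkSpanSingleton' f₀ (p f₀) hspan) p hom hadd (by
        rintro ⟨x, hx⟩
        obtain ⟨c, rfl⟩ := Submodule.mem_span_singleton.mp hx
        rw [LinearPMap.mkSpanSingleton'_apply]
        exact hline c)
    refine ⟨L, ?_, h2⟩
    have := h1 ⟨f₀, Submodule.mem_span_singleton_self f₀⟩
    rw [this]
    exact LinearPMap.mkSpanSingleton'_apply_self f₀ _ hspan _
  exact ⟨L, hL, fun f c hc => (hLp f).trans (csInf_le (hbd f) hc)⟩

end Algebra

/-! ### Weak duality: gains under a martingale measure. -/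

section WeakDuality

/-- A sum of successive increments, each of which integrates to zero along a localizing sequence
of sets known at the preceding date, is integrable with non-positive integral as soon as its
negative part is integrable. -/
theorem integrable_sum_of_localized {Ω : Type*} {m0 : MeasurableSpace Ω} {μ : Measure Ω}
    [IsFiniteMeasure μ] (N : ℕ) (m : Fin N → MeasurableSpace Ω) (hm : ∀ k, m k ≤ m0)
    (D : Fin N → Ω → ℝ) (hD : ∀ k, Measurable (D k))
    (hDm : ∀ i j, i < j → Measurable[m j] (D i))
    (A : Fin N → ℕ → Set Ω) (hA : ∀ k r, MeasurableSet[m k] (A k r))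
    (hAmem : ∀ k x, ∀ᶠ r in atTop, x ∈ A k r)
    (hzero : ∀ k r B, MeasurableSet[m k] B → B ⊆ A k r →
      IntegrableOn (D k) B μ ∧ ∫ x in B, D k x ∂μ = 0)
    (f : Ω → ℝ) (hf : Integrable f μ) (hle : ∀ᵐ x ∂μ, -f x ≤ ∑ k, D k x) :
    Integrable (fun x => ∑ k, D k x) μ ∧ ∫ x, ∑ k, D k x ∂μ ≤ 0 := by
  induction N generalizing f with
  | zero => simp
  | succ N ih =>
    set P : Ω → ℝ := fun x => ∑ k : Fin N, D k.castSucc x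
    set l := Fin.last N
    have hPl : Measurable[m l] P :=
      Finset.measurable_fun_sum _ fun i _ => hDm _ _ (Fin.castSucc_lt_last i)
    have hPm : Measurable P := hPl.mono (hm l) le_rfl
    simp_rw [Fin.sum_univ_castSucc] at hle ⊢
    change ∀ᵐ x ∂μ, -f x ≤ P x + D l x at hle
    change Integrable (fun x => P x + D l x) μ ∧ ∫ x, P x + D l x ∂μ ≤ 0
    -- These sets are known before the last increment, exhaust `Ω`, and make `P` bounded, so on them
    -- `P` and `P + D l` have equal integrals.
    let C : ℕ → Set Ω := fun r => A l r ∩ {x | |P x| ≤ r}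
    have hC : ∀ r, MeasurableSet[m l] (C r) := fun r =>
      (hA l r).inter (measurableSet_le (measurable_norm.comp hPl) measurable_const)
    have hcov : AECover μ atTop C := by
      refine ⟨ae_of_all _ fun x => ?_, fun r => hm l _ (hC r)⟩
      filter_upwards [hAmem l x, eventually_ge_atTop ⌈|P x|⌉₊] with r h1 h2
      exact ⟨h1, Nat.ceil_le.mp h2⟩
    have hPint : ∀ r B, B ⊆ C r → IntegrableOn P B μ := by
      intro r B hB
      refine IntegrableOn.mono_set ?_ hB
      refine Measure.integrableOn_of_bounded (M := r) (measure_ne_top _ _)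
        hPm.aestronglyMeasurable ?_
      exact (ae_restrict_iff' (hm l _ (hC r))).mpr (ae_of_all _ fun x hx => hx.2)
    have hset : ∀ r B, MeasurableSet[m l] B → B ⊆ C r →
        IntegrableOn (fun x => P x + D l x) B μ ∧ ∫ x in B, P x + D l x ∂μ = ∫ x in B, P x ∂μ := by
      intro r B hB hBC
      obtain ⟨h1, h2⟩ := hzero l r B hB (hBC.trans Set.inter_subset_left)
      refine ⟨(hPint r B hBC).add h1, ?_⟩
      rw [integral_add (hPint r B hBC) h1, h2, add_zero]
    have hneg : Integrable (fun x => max (-P x) 0) μ := by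
      refine hcov.integrable_of_integral_bounded_of_nonneg_ae (∫ x, |f x| ∂μ) (fun r => ?_)
        (ae_of_all _ fun x => le_max_right _ _) (Eventually.of_forall fun r => ?_)
      · exact (hPint r _ le_rfl).neg.sup (integrable_zero _ _ _)
      -- The sign of `P` is also known before the last increment, so the negative part of `P` on `C
      -- r` has the integral of `-(P + D l)` over this set, which is at most `∫ |f|`.
      · have hB : MeasurableSet[m l] (C r ∩ {x | P x ≤ 0}) :=
          (hC r).inter (measurableSet_le hPl measurable_const)
        obtain ⟨h1, h2⟩ := hset r _ hB Set.inter_subset_left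
        have e : ∫ x in C r, max (-P x) 0 ∂μ = -∫ x in C r ∩ {x | P x ≤ 0}, P x ∂μ := by
          rw [← integral_neg,
            ← setIntegral_indicator (hm l _ (measurableSet_le hPl measurable_const))]
          congr 1
          ext x
          by_cases h : P x ≤ 0
          · rw [Set.indicator_of_mem (by exact h), max_eq_left (by linarith)]
          · rw [Set.indicator_of_notMem (by exact h), max_eq_right (by linarith)]
        rw [e, ← h2, ← integral_neg]
        refine (setIntegral_mono_ae h1.neg hf.abs.integrableOn ?_).trans
          (setIntegral_le_integral hf.abs (ae_of_all _ fun x => abs_nonneg _))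
        filter_upwards [hle] with x hx
        have := le_abs_self (f x)
        simp only [Pi.neg_apply]
        linarith
    -- The negative part of `P` now serves as the integrable bound for the shorter sum.
    obtain ⟨hPi, hP0⟩ := ih (fun k => m k.castSucc) (fun k => hm _) (fun k => D k.castSucc)
      (fun k => hD _) (fun i j h => hDm _ _ (Fin.castSucc_lt_castSucc_iff.mpr h))
      (fun k => A k.castSucc) (fun k => hA _) (fun k => hAmem _) (fun k => hzero _)
      (fun x => max (-P x) 0) hneg (ae_of_all _ fun x => by
        have := le_max_left (-P x) 0
        change -max (-P x) 0 ≤ P x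
        linarith)
    have hsum : Integrable (fun x => P x + D l x + |f x|) μ := by
      refine hcov.integrable_of_integral_bounded_of_nonneg_ae (∫ x, |P x| ∂μ + ∫ x, |f x| ∂μ)
        (fun r => ((hset r _ (hC r) le_rfl).1.add hf.abs.integrableOn)) ?_
        (Eventually.of_forall fun r => ?_)
      · filter_upwards [hle] with x hx
        have := le_abs_self (f x)
        linarith
      · obtain ⟨h1, h2⟩ := hset r _ (hC r) le_rfl
        rw [integral_add h1 hf.abs.integrableOn, h2]
        refine add_le_add ((setIntegral_mono_ae hPi.integrableOn hPi.abs.integrableOn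
          (ae_of_all _ fun x => le_abs_self _)).trans ?_) ?_
        · exact setIntegral_le_integral hPi.abs (ae_of_all _ fun x => abs_nonneg _)
        · exact setIntegral_le_integral hf.abs (ae_of_all _ fun x => abs_nonneg _)
    have hint : Integrable (fun x => P x + D l x) μ := by
      refine (hsum.sub hf.abs).congr (ae_of_all _ fun x => ?_)
      simp
    refine ⟨hint, ?_⟩
    have t1 := hcov.integral_tendsto_of_countably_generated hint
    have t2 := hcov.integral_tendsto_of_countably_generated hPi
    simp_rw [fun r => (hset r _ (hC r) le_rfl).2] at t1
    rw [tendsto_nhds_unique t1 t2]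
    exact hP0

variable {d : ℕ} {T : ℕ∞} {X : Period T → Set (Vec d)} {ν : ∀ n, Measure (X n)} {s₀ : Vec d}

/-- Cut off to `B`, the holding is bounded and `m`-measurable, so it can be pulled out of the
conditional expectation, which vanishes. -/
theorem setIntegral_inner_increment_eq_zero {Ω : Type*} {m m0 : MeasurableSpace Ω} (hm : m ≤ m0)
    {μ : Measure Ω} [IsFiniteMeasure μ] {ξ h : Ω → Vec d} (hξ : Integrable ξ μ)
    (hξ0 : μ[ξ | m] =ᵐ[μ] 0) (hh : Measurable[m] h) (r : ℝ) (B : Set Ω) (hB : MeasurableSet[m] B)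
    (hr : ∀ x ∈ B, ‖h x‖ ≤ r) :
    IntegrableOn (fun x => (inner ℝ (h x) (ξ x) : ℝ)) B μ ∧
      ∫ x in B, (inner ℝ (h x) (ξ x) : ℝ) ∂μ = 0 := by
  have hB0 := hm _ hB
  have hind : StronglyMeasurable[m] (B.indicator h) :=
    (hh.indicator hB).stronglyMeasurable
  have hbd : ∀ x, ‖B.indicator h x‖ ≤ max r 0 := by
    intro x
    by_cases hx : x ∈ B
    · rw [Set.indicator_of_mem hx]; exact (hr x hx).trans (le_max_left _ _)
    · rw [Set.indicator_of_notMem hx]; simp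
  have heq : B.indicator (fun x => (inner ℝ (h x) (ξ x) : ℝ))
      = fun x => innerSL ℝ (B.indicator h x) (ξ x) := by
    ext x
    by_cases hx : x ∈ B <;> simp [hx]
  have hi : Integrable (fun x => innerSL ℝ (B.indicator h x) (ξ x)) μ := by
    refine (hξ.norm.const_mul (max r 0)).mono' ?_ (ae_of_all _ fun x => ?_)
    · simp only [innerSL_apply_apply]
      exact (hind.mono hm).aestronglyMeasurable.inner hξ.1
    · rw [innerSL_apply_apply]
      exact (norm_inner_le_norm _ _).trans (mul_le_mul_of_nonneg_right (hbd x) (norm_nonneg _))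
  rw [← integrable_indicator_iff hB0, ← integral_indicator hB0, heq]
  refine ⟨hi, ?_⟩
  rw [← integral_condExp hm]
  have := condExp_stronglyMeasurable_bilin_of_bound (innerSL ℝ) hm hind hξ (max r 0)
    (ae_of_all μ hbd)
  rw [integral_congr_ae this]
  refine integral_eq_zero_of_ae ?_
  filter_upwards [hξ0] with x hx
  simp [hx]

theorem measurable_price_filtration (X : Period T → Set (Vec d)) (s₀ : Vec d) {i j : Time T}
    (hij : i ≤ j) : Measurable[priceFiltration X s₀ j] (price X s₀ i) := by
  refine Measurable.mono (comap_measurable (price X s₀ i)) ?_ le_rfl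
  exact le_iSup₂_of_le (f := fun k (_ : k ≤ j) => MeasurableSpace.comap (price X s₀ k) _) i hij le_rfl

/-- The localizing sets are those where the holding has norm at most `r`; on them each increment of
the gains integrates to zero. -/
theorem IsGain.integrable {μ : Measure (PathSpace X)} [IsFiniteMeasure μ]
    (hμ : Martingale (price X s₀) (priceFiltration X s₀) μ) {g : PathSpace X → ℝ}
    (hg : IsGain X s₀ g) {f : PathSpace X → ℝ} (hf : Integrable f μ)
    (hle : ∀ᵐ x ∂μ, -f x ≤ g x) : Integrable g μ ∧ ∫ x, g x ∂μ ≤ 0 := by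
  obtain ⟨⟨N, hN, h, hh⟩, rfl⟩ := hg
  have hlt : ∀ k : Fin N, ((k : ℕ) : ℕ∞) ≤ T := fun k =>
    le_trans (Nat.cast_le.mpr (Nat.le_of_lt k.isLt)) hN
  have hlt' : ∀ k : Fin N, ((k + 1 : ℕ) : ℕ∞) ≤ T := fun k =>
    le_trans (Nat.cast_le.mpr (Nat.succ_le_of_lt k.isLt)) hN
  refine integrable_sum_of_localized N (fun k => priceFiltration X s₀ ⟨k, hlt k⟩)
    (fun k => (priceFiltration X s₀).le _) _ (fun k => ?_) (fun i j hij => ?_)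
    (fun k r => {x | ‖h k x‖ ≤ r}) (fun k r => ?_) (fun k x => ?_) (fun k r B hB hBr => ?_) f hf hle
  · exact ((hh k).mono ((priceFiltration X s₀).le _) le_rfl).inner
      ((measurable_price _ _ _).sub (measurable_price _ _ _))
  · have hij' : i.1 < j.1 := hij
    refine @Measurable.inner _ _ _ (_) _ _ _ _ _ _ _ _ ?_ (@Measurable.sub _ _ _ _ _ (_) _ _ ?_ ?_)
    · exact (hh i).mono ((priceFiltration X s₀).mono (Subtype.mk_le_mk.mpr hij'.le)) le_rfl
    · exact measurable_price_filtration X s₀ (Subtype.mk_le_mk.mpr hij')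
    · exact measurable_price_filtration X s₀ (Subtype.mk_le_mk.mpr hij'.le)
  · exact measurableSet_le (measurable_norm.comp (hh k)) measurable_const
  · filter_upwards [eventually_ge_atTop ⌈‖h k x‖⌉₊] with r h2
    exact Nat.ceil_le.mp h2
  · have hle : (⟨k, hlt k⟩ : Time T) ≤ ⟨k + 1, hlt' k⟩ := Subtype.mk_le_mk.mpr (Nat.le_succ _)
    refine setIntegral_inner_increment_eq_zero ((priceFiltration X s₀).le _)
      ((hμ.integrable _).sub (hμ.integrable _)) ?_ (hh k) r B hB hBr
    refine (condExp_sub (hμ.integrable _) (hμ.integrable _) _).trans ?_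
    filter_upwards [hμ.condExp_ae_eq hle, hμ.condExp_ae_eq (le_refl (⟨k, hlt k⟩ : Time T))]
      with x h1 h2
    simp [h1, h2]

theorem OptionPortfolio.lintegral_payoff (G : OptionPortfolio X ν) {μ : Measure (PathSpace X)}
    (hμ : μ ∈ couplings X ν) :
    ∫⁻ x, G.payoff x ∂μ = ∑' n, ∫⁻ y, (G.g n y : ℝ≥0∞) ∂(ν n) := by
  unfold payoff
  have hm : ∀ n, Measurable fun x : PathSpace X => (G.g n (x n) : ℝ≥0∞) := fun n =>
    ((G.measurable_g n).comp (measurable_pi_apply n)).coe_nnreal_ennreal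
  rw [lintegral_tsum fun n => (hm n).aemeasurable]
  refine tsum_congr fun n => ?_
  rw [← hμ.2 n, lintegral_map (G.measurable_g n).coe_nnreal_ennreal (measurable_pi_apply n)]

theorem OptionPortfolio.lintegral_payoff_ne_top (G : OptionPortfolio X ν)
    {μ : Measure (PathSpace X)} (hμ : μ ∈ couplings X ν) : ∫⁻ x, G.payoff x ∂μ ≠ ∞ := by
  rw [G.lintegral_payoff hμ]; exact G.price_lt_top.ne

theorem OptionPortfolio.integrable_payoff (G : OptionPortfolio X ν) {μ : Measure (PathSpace X)}
    (hμ : μ ∈ couplings X ν) : Integrable (fun x => (G.payoff x).toReal) μ :=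
  integrable_toReal_of_lintegral_ne_top G.measurable_payoff.aemeasurable
    (G.lintegral_payoff_ne_top hμ)

theorem OptionPortfolio.ae_payoff_ne_top (G : OptionPortfolio X ν) {μ : Measure (PathSpace X)}
    (hμ : μ ∈ couplings X ν) : ∀ᵐ x ∂μ, G.payoff x ≠ ∞ := by
  filter_upwards [ae_lt_top G.measurable_payoff (G.lintegral_payoff_ne_top hμ)] with x hx
  exact hx.ne

theorem OptionPortfolio.integral_payoff (G : OptionPortfolio X ν) {μ : Measure (PathSpace X)}
    (hμ : μ ∈ couplings X ν) : ∫ x, (G.payoff x).toReal ∂μ = G.cost := by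
  rw [integral_toReal G.measurable_payoff.aemeasurable
    (ae_lt_top G.measurable_payoff (G.lintegral_payoff_ne_top hμ)), G.lintegral_payoff hμ]
  rfl

/-- Option payoffs are infinite only on a null set, and superhedging the integrable `f` is exactly
the integrable lower bound on the gains that `IsGain.integrable` requires. -/
theorem exists_integrable_majorant_of_mem_hedgeCosts {μ : Measure (PathSpace X)}
    (hμ : μ ∈ martingaleMeasures X ν s₀) {f : PathSpace X → ℝ} (hf : Integrable f μ)
    (θ : SemiStatic X ν s₀) (hθ : ∀ x, (f x : EReal) ≤ θ.outcome x) :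
    ∃ F : PathSpace X → ℝ, Integrable F μ ∧ (∀ᵐ x ∂μ, θ.outcome x = F x) ∧ ∫ x, F x ∂μ ≤ θ.cost := by
  have := hμ.1.1
  have hP := θ.options.integrable_payoff hμ.1
  have hout : ∀ᵐ x ∂μ, θ.outcome x
      = ((θ.m + (θ.options.payoff x).toReal + θ.trading.gains x : ℝ) : EReal) := by
    filter_upwards [θ.options.ae_payoff_ne_top hμ.1] with x hx
    unfold SemiStatic.outcome
    rw [EReal.coe_add, EReal.coe_add, EReal.coe_ennreal_toReal hx]
  obtain ⟨h1, h2⟩ := IsGain.integrable hμ.2 ⟨θ.trading, rfl⟩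
    (f := fun x => θ.m + (θ.options.payoff x).toReal - f x)
    (((integrable_const _).add hP).sub hf) (by
      filter_upwards [hout] with x hx
      have := hθ x
      rw [hx, EReal.coe_le_coe_iff] at this
      linarith)
  refine ⟨_, ((integrable_const _).add hP).add h1, hout, ?_⟩
  have e : ∫ x, (θ.m + (θ.options.payoff x).toReal + θ.trading.gains x) ∂μ
      = θ.m + θ.options.cost + ∫ x, θ.trading.gains x ∂μ := by
    rw [integral_add (f := fun x => θ.m + (θ.options.payoff x).toReal)
      ((integrable_const _).add hP) h1, integral_add (integrable_const _) hP,
      θ.options.integral_payoff hμ.1]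
    simp
  refine (le_of_eq e).trans ?_
  unfold SemiStatic.cost
  linarith

theorem integral_le_of_mem_hedgeCosts {μ : Measure (PathSpace X)}
    (hμ : μ ∈ martingaleMeasures X ν s₀) {f : PathSpace X → ℝ} (hf : Integrable f μ)
    {c : ℝ} (hc : c ∈ hedgeCosts X ν s₀ f) : ∫ x, f x ∂μ ≤ c := by
  obtain ⟨θ, hθ, rfl⟩ := hc
  obtain ⟨F, hF, hout, hle⟩ := exists_integrable_majorant_of_mem_hedgeCosts hμ hf θ hθ
  refine (integral_mono_ae hf hF ?_).trans hle
  filter_upwards [hout] with x hx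
  have := hθ x
  rwa [hx, EReal.coe_le_coe_iff] at this

theorem not_isModelIndependentArbitrage (hμ : (martingaleMeasures X ν s₀).Nonempty) :
    ¬ ∃ θ : SemiStatic X ν s₀, θ.IsModelIndependentArbitrage := by
  rintro ⟨θ, hcost, hpos⟩
  obtain ⟨μ, hμ⟩ := hμ
  have := hμ.1.1
  obtain ⟨F, hF, hout, hle⟩ := exists_integrable_majorant_of_mem_hedgeCosts hμ
    (integrable_zero _ _ _) θ (fun x => (hpos x).le)
  have hF0 : ∀ᵐ x ∂μ, 0 < F x := by
    filter_upwards [hout] with x hx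
    have := hpos x
    rwa [hx, EReal.coe_pos] at this
  have : 0 < ∫ x, F x ∂μ := by
    rw [integral_pos_iff_support_of_nonneg_ae (hF0.mono fun x hx => hx.le) hF]
    have : μ (Function.support F) = μ Set.univ :=
      measure_congr (eventuallyEq_univ.mpr (hF0.mono fun x hx => hx.ne'))
    simp [this]
  linarith

/-- Replacing the cash `m` by minus the option cost makes the total cost zero and raises the outcome
by a positive constant. -/
theorem not_isUniformArbitrage
    (h : ¬ ∃ θ : SemiStatic X ν s₀, θ.IsModelIndependentArbitrage) :
    ¬ ∃ θ : SemiStatic X ν s₀, θ.IsUniformArbitrage := by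
  rintro ⟨⟨m, G, H⟩, hcost, hpos⟩
  refine h ⟨⟨-G.cost, G, H⟩, by simp [SemiStatic.cost], fun x => ?_⟩
  have h1 := (real_le_outcome_iff 0 m (H.gains x) (G.payoff x)).mp (hpos x)
  simp only [SemiStatic.cost] at hcost
  refine lt_of_lt_of_le (EReal.coe_pos.mpr (by linarith : 0 < -(m + G.cost)))
    ((real_le_outcome_iff _ _ _ _).mpr ?_)
  convert h1 using 2
  ring

end WeakDuality

/-! ### Positive functionals as measures, via compactification. -/

section Representation

/-- An upper semicontinuous function bounded above on a subspace of a compact metrizable space is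
a pointwise limit of restrictions of continuous functions on the compact space, from above. -/
theorem exists_continuous_approx_of_upperSemicontinuous {Y K : Type*} [TopologicalSpace Y]
    [Nonempty Y] [TopologicalSpace K] [CompactSpace K] [TopologicalSpace.MetrizableSpace K]
    {j : Y → K} (hj : IsInducing j) {u : Y → ℝ} (hu : UpperSemicontinuous u) {C : ℝ}
    (hC : ∀ y, u y ≤ C) :
    ∃ v : ℕ → C(K, ℝ), (∀ k y, u y ≤ v k (j y)) ∧ (∀ k y, v k (j y) ≤ C) ∧
      ∀ y, Tendsto (fun k => v k (j y)) atTop (𝓝 (u y)) := by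
  let _ := TopologicalSpace.metrizableSpaceMetric K
  -- The sup-convolution of `u` is `k`-Lipschitz. Near `j y` semicontinuity controls it; at distance
  -- at least `δ` the penalty `k * δ` eventually exceeds `C - b`.
  let w : ℕ → K → ℝ := fun k z => ⨆ y, (u y - k * dist z (j y))
  have hle : ∀ (k : ℕ) z y, u y - k * dist z (j y) ≤ C := fun k z y =>
    (sub_le_self _ (by positivity)).trans (hC y)
  have hbdd : ∀ (k : ℕ) z, BddAbove (Set.range fun y => u y - k * dist z (j y)) := fun k z =>
    ⟨C, by rintro _ ⟨y, rfl⟩; exact hle k z y⟩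
  have hlip : ∀ k : ℕ, LipschitzWith k (w k) := by
    intro k
    refine LipschitzWith.of_le_add_mul _ fun z z' => ciSup_le fun y => ?_
    have h1 := le_ciSup (hbdd k z') y
    have h2 := mul_le_mul_of_nonneg_left (dist_triangle_left z' (j y) z) (Nat.cast_nonneg (α := ℝ) k)
    simp only [NNReal.coe_natCast]
    change u y - k * dist z' (j y) ≤ w k z' at h1
    linarith
  have hge : ∀ k y, u y ≤ w k (j y) := fun k y => by
    have := le_ciSup (hbdd k (j y)) y
    simpa using this
  refine ⟨fun k => ⟨w k, (hlip k).continuous⟩, hge, fun k y => ciSup_le fun y' => hle k _ y',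
    fun y => ?_⟩
  refine tendsto_order.mpr ⟨fun a ha => Eventually.of_forall fun k => ha.trans_le (hge k y),
    fun a ha => ?_⟩
  obtain ⟨b, hb, hba⟩ := exists_between ha
  have hnear := hu y b hb
  rw [hj.nhds_eq_comap, (Metric.nhds_basis_ball.comap j).eventually_iff] at hnear
  obtain ⟨δ, hδ, hball⟩ := hnear
  obtain ⟨k₀, hk₀⟩ := exists_nat_ge ((C - b) / δ)
  filter_upwards [eventually_ge_atTop k₀] with k hk
  refine lt_of_le_of_lt (ciSup_le fun y' => ?_) hba
  by_cases hy' : dist (j y') (j y) < δ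
  · exact (sub_le_self _ (by positivity)).trans (hball hy').le
  · rw [not_lt, dist_comm] at hy'
    have h1 : (C - b) ≤ k * δ := by
      rw [← div_le_iff₀ hδ]
      exact hk₀.trans (Nat.cast_le.mpr hk)
    have h2 := mul_le_mul_of_nonneg_left hy' (Nat.cast_nonneg (α := ℝ) k)
    linarith [hC y']

theorem exists_measure_of_positive_functional {K : Type*} [TopologicalSpace K] [CompactSpace K]
    [T2Space K] [MeasurableSpace K] [BorelSpace K] (Λ : C(K, ℝ) →ₗ[ℝ] ℝ)
    (hΛ : ∀ v, 0 ≤ v → 0 ≤ Λ v) (hone : Λ 1 = 1) :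
    ∃ ρ : Measure K, IsProbabilityMeasure ρ ∧ ∀ v : C(K, ℝ), ∫ z, v z ∂ρ = Λ v := by
  let Φ : CompactlySupportedContinuousMap K ℝ →ₗ[ℝ] ℝ :=
    { toFun := fun f => Λ f.toContinuousMap
      map_add' := fun f g => Λ.map_add _ _
      map_smul' := fun c f => Λ.map_smul c _ }
  let Ψ : CompactlySupportedContinuousMap K ℝ →ₚ[ℝ] ℝ :=
    PositiveLinearMap.mk₀ Φ fun f hf => hΛ _ fun z => hf z
  have hint : ∀ v : C(K, ℝ), ∫ z, v z ∂(RealRMK.rieszMeasure Ψ) = Λ v := fun v =>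
    RealRMK.integral_rieszMeasure Ψ ⟨v, HasCompactSupport.of_compactSpace _⟩
  refine ⟨RealRMK.rieszMeasure Ψ, ⟨?_⟩, hint⟩
  have h1 := hint 1
  rw [hone] at h1
  simp only [ContinuousMap.one_apply, integral_const, smul_eq_mul, mul_one] at h1
  rw [← ENNReal.ofReal_toReal (measure_ne_top (RealRMK.rieszMeasure Ψ) Set.univ)]
  change ENNReal.ofReal ((RealRMK.rieszMeasure Ψ).real Set.univ) = 1
  rw [h1, ENNReal.ofReal_one]

/-- A normalized positive functional on the continuous functions on a product of compactifications
whose marginals live on the original spaces is given by a measure on the original product. -/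
theorem exists_coupling_of_positive_functional {ι : Type*} [Countable ι] {Y K : ι → Type*}
    [∀ i, TopologicalSpace (Y i)] [∀ i, PolishSpace (Y i)] [∀ i, MeasurableSpace (Y i)]
    [∀ i, BorelSpace (Y i)] [∀ i, TopologicalSpace (K i)] [∀ i, CompactSpace (K i)]
    [∀ i, TopologicalSpace.MetrizableSpace (K i)] [∀ i, SecondCountableTopology (K i)]
    [∀ i, MeasurableSpace (K i)]
    [∀ i, BorelSpace (K i)] (e : ∀ i, Y i → K i) (he : ∀ i, IsEmbedding (e i))
    (ν : ∀ i, Measure (Y i)) [∀ i, IsProbabilityMeasure (ν i)] (Λ : C(∀ i, K i, ℝ) →ₗ[ℝ] ℝ)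
    (hΛ : ∀ v, 0 ≤ v → 0 ≤ Λ v) (hone : Λ 1 = 1)
    (hmarg : ∀ i (w : C(K i, ℝ)), Λ (w.comp ⟨fun z => z i, continuous_apply i⟩)
      = ∫ y, w (e i y) ∂(ν i)) :
    ∃ μ : Measure (∀ i, Y i), IsProbabilityMeasure μ ∧ (∀ i, μ.map (fun x => x i) = ν i) ∧
      ∀ v : C(∀ i, K i, ℝ), ∫ x, v (Pi.map e x) ∂μ = Λ v := by
  obtain ⟨ρ, hρ, hint⟩ := exists_measure_of_positive_functional Λ hΛ hone
  have heM : ∀ i, MeasurableEmbedding (e i) := fun i =>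
    (he i).continuous.measurableEmbedding (he i).injective
  have hjE : IsEmbedding (Pi.map e) := IsEmbedding.piMap he
  have hjM : MeasurableEmbedding (Pi.map e) :=
    hjE.continuous.measurableEmbedding hjE.injective
  have hρm : ∀ i, ρ.map (fun z => z i) = (ν i).map (e i) := by
    intro i
    have : IsProbabilityMeasure ((ν i).map (e i)) :=
      Measure.isProbabilityMeasure_map (heM i).measurable.aemeasurable
    have : IsProbabilityMeasure (ρ.map fun z => z i) :=
      Measure.isProbabilityMeasure_map (measurable_pi_apply i).aemeasurable
    refine ext_of_forall_integral_eq_of_IsFiniteMeasure fun w => ?_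
    rw [integral_map (measurable_pi_apply i).aemeasurable
      w.continuous.measurable.aestronglyMeasurable,
      integral_map (heM i).measurable.aemeasurable w.continuous.measurable.aestronglyMeasurable]
    exact (hint _).trans (hmarg i w.toContinuousMap)
  -- No mass sits on the added boundary: each coordinate avoids it almost surely by its marginal,
  -- and there are countably many coordinates.
  have hrange : ∀ᵐ z ∂ρ, z ∈ Set.range (Pi.map e) := by
    have h1 : ∀ i, ∀ᵐ z ∂ρ, z i ∈ Set.range (e i) := by
      intro i
      have h2 : ∀ᵐ y ∂(ρ.map fun z => z i), y ∈ Set.range (e i) := by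
        rw [hρm i, (heM i).ae_map_iff]
        exact ae_of_all _ fun y => ⟨y, rfl⟩
      exact ae_of_ae_map (measurable_pi_apply i).aemeasurable h2
    filter_upwards [ae_all_iff.mpr h1] with z hz
    choose y hy using hz
    exact ⟨y, funext hy⟩
  have hmap : (ρ.comap (Pi.map e)).map (Pi.map e) = ρ := by
    rw [hjM.map_comap, Measure.restrict_eq_self_of_ae_mem hrange]
  refine ⟨ρ.comap (Pi.map e), ⟨?_⟩, fun i => ?_, fun v => ?_⟩
  · have := congrArg (fun m => m Set.univ) hmap
    simpa [hjM.map_apply] using this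
  · have h1 : ((ρ.comap (Pi.map e)).map fun x => x i).map (e i) = (ν i).map (e i) := by
      rw [Measure.map_map (heM i).measurable (measurable_pi_apply i), ← hρm i]
      conv_rhs => rw [← hmap]
      rw [Measure.map_map (measurable_pi_apply i) hjM.measurable]
      rfl
    rw [← (heM i).comap_map (Measure.map _ _), h1, (heM i).comap_map]
  · rw [← hint v]
    conv_rhs => rw [← hmap]
    rw [hjM.integral_map]

/-- The embedding of a vector space into its closed unit ball. -/
def toClosedBall {E : Type*} [SeminormedAddCommGroup E] [NormedSpace ℝ E] (x : E) :
    Metric.closedBall (0 : E) 1 :=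
  Set.inclusion Metric.ball_subset_closedBall (Homeomorph.unitBall x)

theorem isEmbedding_toClosedBall {E : Type*} [SeminormedAddCommGroup E] [NormedSpace ℝ E] :
    IsEmbedding (toClosedBall : E → Metric.closedBall (0 : E) 1) :=
  (IsEmbedding.inclusion Metric.ball_subset_closedBall).comp Homeomorph.unitBall.isEmbedding

end Representation

/-! ### From the pricing functional to a martingale measure. -/

section Duality

/-- The images under `p` of the measures with densities `ξ⁺` and `ξ⁻` are finite and agree on
bounded continuous functions, hence coincide. -/
theorem setIntegral_preimage_eq_zero {Ω Y : Type*} [MeasurableSpace Ω] {μ : Measure Ω}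
    [TopologicalSpace Y] [MeasurableSpace Y] [HasOuterApproxClosed Y] [BorelSpace Y] {p : Ω → Y}
    (hp : Measurable p) {ξ : Ω → ℝ} (hξm : Measurable ξ) (hξ : Integrable ξ μ)
    (hzero : ∀ w : BoundedContinuousFunction Y ℝ, ∫ x, w (p x) * ξ x ∂μ = 0) {B : Set Y}
    (hB : MeasurableSet B) : ∫ x in p ⁻¹' B, ξ x ∂μ = 0 := by
  have hfin : ∀ η : Ω → ℝ, Integrable η μ →
      IsFiniteMeasure ((μ.withDensity fun x => ENNReal.ofReal (η x)).map p) := fun η hη => by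
    have := isFiniteMeasure_withDensity_ofReal hη.2
    infer_instance
  have hpos := hfin ξ hξ
  have hneg := hfin _ hξ.neg
  have hw : ∀ (w : BoundedContinuousFunction Y ℝ) (η : Ω → ℝ), Measurable η → Integrable η μ →
      ∫ y, w y ∂((μ.withDensity fun x => ENNReal.ofReal (η x)).map p)
        = ∫ x, w (p x) * max (η x) 0 ∂μ := by
    intro w η hηm hη
    rw [integral_map hp.aemeasurable w.continuous.measurable.aestronglyMeasurable,
      integral_withDensity_eq_integral_toReal_smul hηm.ennreal_ofReal
        (ae_of_all _ fun x => ENNReal.ofReal_lt_top)]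
    congr 1
    ext x
    rw [ENNReal.toReal_ofReal', smul_eq_mul, mul_comm]
  have hint : ∀ (w : BoundedContinuousFunction Y ℝ) (η : Ω → ℝ), Integrable η μ →
      Integrable (fun x => w (p x) * max (η x) 0) μ := fun w η hη =>
    (hη.sup (integrable_zero _ _ _)).bdd_mul
      (w.continuous.measurable.comp hp).aestronglyMeasurable
      (c := ‖w‖) (ae_of_all _ fun x => w.norm_coe_le_norm _)
  have heq : (μ.withDensity fun x => ENNReal.ofReal (ξ x)).map p
      = (μ.withDensity fun x => ENNReal.ofReal (-ξ x)).map p := by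
    refine ext_of_forall_integral_eq_of_IsFiniteMeasure fun w => ?_
    rw [hw w ξ hξm hξ, hw w (fun x => -ξ x) hξm.neg hξ.neg, ← sub_eq_zero, ← integral_sub (hint w _ hξ)
      (hint w (fun x => -ξ x) hξ.neg)]
    refine Eq.trans ?_ (hzero w)
    congr 1
    ext x
    rw [← mul_sub]
    congr 1
    exact max_zero_sub_max_neg_zero_eq_self (ξ x)
  have happ := congrArg (fun m => m B) heq
  simp only [Measure.map_apply hp hB, withDensity_apply _ (hp hB)] at happ
  rw [integral_eq_lintegral_pos_part_sub_lintegral_neg_part hξ.integrableOn, happ, sub_self]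

variable {d : ℕ} {T : ℕ∞} {X : Period T → Set (Vec d)} {ν : ∀ n, Measure (X n)} {s₀ : Vec d}

theorem mem_dominatedSpace_of_abs_le {f : PathSpace X → ℝ} (M : ℝ) (G : OptionPortfolio X ν)
    (h : ∀ x, |f x| ≤ M + (G.payoff x).toReal) : f ∈ dominatedSpace X ν := by
  refine ⟨M.toNNReal, G, fun x => ?_⟩
  rw [Real.enorm_eq_ofReal_abs]
  refine (ENNReal.ofReal_le_ofReal (h x)).trans (ENNReal.ofReal_add_le.trans ?_)
  exact add_le_add le_rfl ENNReal.ofReal_toReal_le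

theorem integrable_of_mem_dominatedSpace {f : PathSpace X → ℝ} (hf : f ∈ dominatedSpace X ν)
    (hfm : Measurable f) {μ : Measure (PathSpace X)} (hμ : μ ∈ couplings X ν) :
    Integrable f μ := by
  obtain ⟨M, G, h⟩ := hf
  have := hμ.1
  refine ⟨hfm.aestronglyMeasurable, (lintegral_mono h).trans_lt ?_⟩
  rw [lintegral_add_left measurable_const]
  exact ENNReal.add_lt_top.mpr ⟨by simp, (G.lintegral_payoff_ne_top hμ).lt_top⟩

theorem continuous_price (X : Period T → Set (Vec d)) (s₀ : Vec d) (t : Time T) :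
    Continuous (price X s₀ t) := by
  unfold price
  split_ifs with h
  · exact continuous_const
  · exact continuous_subtype_val.comp (continuous_apply _)

/-- The first moment makes `‖y‖` an admissible option. Finiteness and continuity of the payoff allow
it to be subtracted from a gain without losing semicontinuity. -/
theorem exists_norm_price_le (hmoment : ∀ n, Integrable (fun y : X n => ‖(y : Vec d)‖) (ν n))
    (t : Time T) : ∃ (M : ℝ) (G : OptionPortfolio X ν), (∀ x, G.payoff x ≠ ∞) ∧
      Continuous (fun x => (G.payoff x).toReal) ∧
      ∀ x, ‖price X s₀ t x‖ ≤ M + (G.payoff x).toReal := by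
  by_cases h : t.1 = 0
  · refine ⟨‖s₀‖, 0, fun x => by simp [OptionPortfolio.payoff_zero],
      by simpa [OptionPortfolio.payoff_zero] using continuous_const, fun x => ?_⟩
    simp [price, h, OptionPortfolio.payoff_zero]
  · refine ⟨0, OptionPortfolio.single ⟨t.1, Nat.one_le_iff_ne_zero.mpr h, t.2⟩
      (fun y => ‖(y : Vec d)‖₊) (by fun_prop) ?_, fun x => ?_, ?_, fun x => ?_⟩
    · simpa [← enorm_eq_nnnorm] using (hmoment ⟨t.1, Nat.one_le_iff_ne_zero.mpr h, t.2⟩).lintegral_lt_top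
    · simp [OptionPortfolio.payoff_single]
    · simp only [OptionPortfolio.payoff_single, ENNReal.coe_toReal, coe_nnnorm]
      fun_prop
    · simp [OptionPortfolio.payoff_single, price, h]

/-- The linear functionals dominated by the superhedging price. -/
def IsPricing (s₀ : Vec d) (L : dominatedSpace X ν →ₗ[ℝ] ℝ) : Prop :=
  ∀ f : dominatedSpace X ν, ∀ c ∈ hedgeCosts X ν s₀ f, L f ≤ c

namespace IsPricing

variable {L : dominatedSpace X ν →ₗ[ℝ] ℝ}

theorem le_cost (hL : IsPricing s₀ L) (f : dominatedSpace X ν) (m : ℝ) (G : OptionPortfolio X ν)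
    (h : ∀ x, ENNReal.ofReal ((f : PathSpace X → ℝ) x - m) ≤ G.payoff x) : L f ≤ m + G.cost :=
  hL f _ (mem_hedgeCosts_of_le m G h)

theorem le_const (hL : IsPricing s₀ L) (f : dominatedSpace X ν) (m : ℝ)
    (h : ∀ x, (f : PathSpace X → ℝ) x ≤ m) : L f ≤ m := by
  have := hL.le_cost f m 0 fun x => by
    rw [ENNReal.ofReal_of_nonpos (by linarith [h x])]; exact zero_le
  rwa [OptionPortfolio.cost_zero, add_zero] at this

theorem mono (hL : IsPricing s₀ L) {f g : dominatedSpace X ν}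
    (h : ∀ x, (f : PathSpace X → ℝ) x ≤ (g : PathSpace X → ℝ) x) : L f ≤ L g := by
  have := hL.le_const (f - g) 0 fun x => by simpa using h x
  rw [map_sub] at this
  linarith

/-- The negative of a gain is a gain, hence superhedged at cost zero. -/
theorem nonneg_of_gain (hL : IsPricing s₀ L) (f : dominatedSpace X ν)
    (hf : IsGain X s₀ (f : PathSpace X → ℝ)) : 0 ≤ L f := by
  have h := hL (-f) 0 (mem_hedgeCosts_of_gain (by simpa using hf.smul (-1)))
  rw [map_neg] at h
  linarith

/-- Options must have nonnegative payoff, so `w` is hedged by the option `w + c` financed with cash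
`-c`. -/
theorem le_marginal [∀ n, IsProbabilityMeasure (ν n)] (hL : IsPricing s₀ L) (n : Period T)
    (w : X n → ℝ) (hw : Measurable w) (hwi : Integrable w (ν n)) (c : ℝ) (hc : ∀ y, -c ≤ w y)
    (f : dominatedSpace X ν) (hf : ∀ x, (f : PathSpace X → ℝ) x = w (x n)) :
    L f ≤ ∫ y, w y ∂(ν n) := by
  have hm : Measurable fun y => (w y + c).toNNReal := (hw.add_const c).real_toNNReal
  have hi : Integrable (fun y => w y + c) (ν n) := hwi.add (integrable_const c)
  have hfin : ∫⁻ y, ((w y + c).toNNReal : ℝ≥0∞) ∂(ν n) < ∞ := hi.lintegral_lt_top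
  have h := hL.le_cost f (-c) (OptionPortfolio.single n _ hm hfin) fun x => by
    rw [OptionPortfolio.payoff_single, hf x, sub_neg_eq_add]; rfl
  rw [OptionPortfolio.cost_single] at h
  have e : (∫⁻ y, ((w y + c).toNNReal : ℝ≥0∞) ∂(ν n)).toReal = ∫ y, (w y + c) ∂(ν n) :=
    (integral_eq_lintegral_of_nonneg_ae (ae_of_all _ fun y => by
      have := hc y
      change 0 ≤ w y + c
      linarith) hi.1).symm
  rw [e, integral_add hwi (integrable_const c)] at h
  simp at h
  exact h

theorem exists_coupling (hX : ∀ n, IsClosed (X n)) [∀ n, IsProbabilityMeasure (ν n)]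
    (hL : IsPricing s₀ L) :
    ∃ μ ∈ couplings X ν, ∀ (u : dominatedSpace X ν) (C : ℝ),
      UpperSemicontinuous (u : PathSpace X → ℝ) → (∀ x, (u : PathSpace X → ℝ) x ≤ C) →
        L u ≤ ∫ x, (u : PathSpace X → ℝ) x ∂μ := by
  -- Closedness enters here: Polishness makes the embeddings into the balls Borel embeddings.
  have hpolish : ∀ n, PolishSpace (X n) := fun n => (hX n).polishSpace
  let e : ∀ n : Period T, X n → Metric.closedBall (0 : Vec d) 1 := fun n y => toClosedBall (y : Vec d)
  have he : ∀ n, IsEmbedding (e n) := fun n => isEmbedding_toClosedBall.comp IsEmbedding.subtypeVal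
  have hj : IsEmbedding (Pi.map e) := IsEmbedding.piMap he
  have hcompact : CompactSpace (Metric.closedBall (0 : Vec d) 1) :=
    isCompact_iff_compactSpace.mp (isCompact_closedBall _ _)
  have hmem : ∀ v : C(Period T → Metric.closedBall (0 : Vec d) 1, ℝ),
      (fun x => v (Pi.map e x)) ∈ dominatedSpace X ν := fun v =>
    mem_dominatedSpace_of_abs_le ‖v‖ 0 fun x => by
      simpa [OptionPortfolio.payoff_zero] using v.norm_coe_le_norm (Pi.map e x)
  let Λ : C(Period T → Metric.closedBall (0 : Vec d) 1, ℝ) →ₗ[ℝ] ℝ :=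
    { toFun := fun v => L ⟨_, hmem v⟩
      map_add' := fun v w => L.map_add ⟨_, hmem v⟩ ⟨_, hmem w⟩
      map_smul' := fun c v => L.map_smul c ⟨_, hmem v⟩ }
  have hΛ : ∀ v, Λ v = L ⟨_, hmem v⟩ := fun v => rfl
  have hle : ∀ n (w : C(Metric.closedBall (0 : Vec d) 1, ℝ)),
      Λ (w.comp ⟨fun z => z n, continuous_apply n⟩) ≤ ∫ y, w (e n y) ∂(ν n) := by
    intro n w
    have hc : Continuous fun y => w (e n y) := w.continuous.comp (he n).continuous
    refine hL.le_marginal n (fun y => w (e n y)) hc.measurable ?_ ‖w‖ (fun y => ?_) _ fun x => rfl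
    · exact Integrable.of_bound hc.measurable.aestronglyMeasurable ‖w‖
        (ae_of_all _ fun y => w.norm_coe_le_norm _)
    · exact (abs_le.mp (w.norm_coe_le_norm (e n y))).1
  have hone : Λ 1 = 1 := by
    refine le_antisymm (hL.le_const _ 1 fun x => le_rfl) ?_
    have h : Λ (-1) ≤ -1 := hL.le_const _ (-1) fun x => le_rfl
    rw [map_neg] at h
    linarith
  have hnonneg : ∀ v, 0 ≤ v → 0 ≤ Λ v := fun v hv => by
    rw [← map_zero L]
    exact hL.mono fun x => hv _
  have hge : ∀ n (w : C(Metric.closedBall (0 : Vec d) 1, ℝ)),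
      ∫ y, w (e n y) ∂(ν n) ≤ Λ (w.comp ⟨fun z => z n, continuous_apply n⟩) := by
    intro n w
    have h := hle n (-w)
    have e1 : (-w).comp ⟨fun z : Period T → Metric.closedBall (0 : Vec d) 1 => z n,
      continuous_apply n⟩ = -(w.comp ⟨fun z => z n, continuous_apply n⟩) := rfl
    rw [e1, map_neg] at h
    simp only [ContinuousMap.neg_apply, integral_neg] at h
    linarith
  obtain ⟨μ, hμ, hmarg, hint⟩ := exists_coupling_of_positive_functional e he ν Λ hnonneg hone
    fun n w => le_antisymm (hle n w) (hge n w)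
  refine ⟨μ, ⟨hμ, hmarg⟩, fun u C hu hC => ?_⟩
  have hne : Nonempty (PathSpace X) := nonempty_of_isProbabilityMeasure μ
  obtain ⟨v, hv1, hv2, hv3⟩ := exists_continuous_approx_of_upperSemicontinuous hj.isInducing hu hC
  have hui : Integrable (u : PathSpace X → ℝ) μ :=
    integrable_of_mem_dominatedSpace u.2 hu.measurable ⟨hμ, hmarg⟩
  refine ge_of_tendsto (tendsto_integral_of_dominated_convergence (F := fun k x => v k (Pi.map e x))
    (fun x => |C| + |(u : PathSpace X → ℝ) x|) (fun k => ?_) ((integrable_const _).add hui.abs)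
    (fun k => ae_of_all _ fun x => ?_) (ae_of_all _ hv3)) (Eventually.of_forall fun k => ?_)
  · exact ((v k).continuous.comp hj.continuous).measurable.aestronglyMeasurable
  · have h1 := hv1 k x
    have h2 := hv2 k x
    rw [Real.norm_eq_abs, abs_le]
    constructor
    · linarith [neg_abs_le ((u : PathSpace X → ℝ) x), abs_nonneg C]
    · linarith [le_abs_self C, abs_nonneg ((u : PathSpace X → ℝ) x)]
  · rw [hint, hΛ]
    exact hL.mono fun x => hv1 k x

/-- A portfolio hedges itself, so `L` prices it at most at its cost, which is its `μ`-integral; the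
semicontinuous part is covered by `hint`. -/
theorem le_integral_add (hL : IsPricing s₀ L) {μ : Measure (PathSpace X)} (hμ : μ ∈ couplings X ν)
    (hint : ∀ (u : dominatedSpace X ν) (C : ℝ),
      UpperSemicontinuous (u : PathSpace X → ℝ) → (∀ x, (u : PathSpace X → ℝ) x ≤ C) →
        L u ≤ ∫ x, (u : PathSpace X → ℝ) x ∂μ) (f : dominatedSpace X ν) {u : PathSpace X → ℝ}
    (hu : UpperSemicontinuous u) {C : ℝ} (hC : ∀ x, u x ≤ C) (G : OptionPortfolio X ν)
    (hG : ∀ x, G.payoff x ≠ ∞)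
    (hf : ∀ x, (f : PathSpace X → ℝ) x = u x + (G.payoff x).toReal) :
    L f ≤ ∫ x, (f : PathSpace X → ℝ) x ∂μ := by
  have hg : (fun x => (G.payoff x).toReal) ∈ dominatedSpace X ν :=
    mem_dominatedSpace_of_abs_le 0 G fun x => by simp
  have hue : u = (f : PathSpace X → ℝ) - fun x => (G.payoff x).toReal := by
    ext x
    simp [hf x]
  have hud : u ∈ dominatedSpace X ν := by
    rw [hue]
    exact sub_mem f.2 hg
  have hfe : f = ⟨u, hud⟩ + ⟨_, hg⟩ := by
    ext x
    exact hf x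
  have hcost : L ⟨_, hg⟩ ≤ 0 + G.cost := hL.le_cost _ 0 G fun x => by
    simp [ENNReal.ofReal_toReal (hG x)]
  have h1 := hint ⟨u, hud⟩ C hu hC
  simp_rw [hf]
  rw [integral_add (integrable_of_mem_dominatedSpace hud hu.measurable hμ) (G.integrable_payoff hμ),
    G.integral_payoff hμ, hfe, map_add]
  linarith

/-- Holding `w(S₀, …, Sₙ) • a` gives a continuous gain dominated by a constant plus a continuous
payoff. Subtracting the payoff leaves a continuous function bounded above, so `0 ≤ L ≤ ∫` on this
gain. -/
theorem setIntegral_increment_eq_zero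
    (hmoment : ∀ n, Integrable (fun y : X n => ‖(y : Vec d)‖) (ν n))
    (hL : IsPricing s₀ L) {μ : Measure (PathSpace X)} (hμ : μ ∈ couplings X ν)
    (hint : ∀ (u : dominatedSpace X ν) (C : ℝ),
      UpperSemicontinuous (u : PathSpace X → ℝ) → (∀ x, (u : PathSpace X → ℝ) x ≤ C) →
        L u ≤ ∫ x, (u : PathSpace X → ℝ) x ∂μ) (n : ℕ) (hn : ((n + 1 : ℕ) : ℕ∞) ≤ T)
    (hn' : (n : ℕ∞) ≤ T) (hS : ∀ t, Integrable (price X s₀ t) μ) {A : Set (PathSpace X)}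
    (hA : MeasurableSet[priceFiltration X s₀ ⟨n, hn'⟩] A) :
    ∫ x in A, (price X s₀ ⟨n + 1, hn⟩ x - price X s₀ ⟨n, hn'⟩ x) ∂μ = 0 := by
  set ξ : PathSpace X → Vec d := fun x => price X s₀ ⟨n + 1, hn⟩ x - price X s₀ ⟨n, hn'⟩ x
  have hξi : Integrable ξ μ := (hS _).sub (hS _)
  have hξc : Continuous ξ := (continuous_price _ _ _).sub (continuous_price _ _ _)
  let p : PathSpace X → (Set.Iic (⟨n, hn'⟩ : Time T) → Vec d) := fun x j => price X s₀ j x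
  have hpc : Continuous p := continuous_pi fun j => continuous_price _ _ _
  have hF : priceFiltration X s₀ ⟨n, hn'⟩ = MeasurableSpace.comap p inferInstance :=
    Filtration.natural_eq_comap _ _ _
  have key : ∀ (w : BoundedContinuousFunction (Set.Iic (⟨n, hn'⟩ : Time T) → Vec d) ℝ) (a : Vec d),
      0 ≤ ∫ x, w (p x) * inner ℝ a (ξ x) ∂μ := by
    intro w a
    obtain ⟨M₁, G₁, h1, h1c, h1b⟩ := exists_norm_price_le (s₀ := s₀) hmoment ⟨n + 1, hn⟩
    obtain ⟨M₂, G₂, h2, h2c, h2b⟩ := exists_norm_price_le (s₀ := s₀) hmoment ⟨n, hn'⟩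
    set c : ℝ≥0 := ‖w‖₊ * ‖a‖₊ with hc
    have hGe : ∀ x, ((c • (G₁ + G₂)).payoff x).toReal
        = c * ((G₁.payoff x).toReal + (G₂.payoff x).toReal) := fun x => by
      rw [OptionPortfolio.payoff_smul, OptionPortfolio.payoff_add, ENNReal.toReal_mul,
        ENNReal.toReal_add (h1 x) (h2 x), ENNReal.coe_toReal]
    have hGt : ∀ x, (c • (G₁ + G₂)).payoff x ≠ ∞ := fun x => by
      rw [OptionPortfolio.payoff_smul, OptionPortfolio.payoff_add]
      exact ENNReal.mul_ne_top (by simp) (ENNReal.add_ne_top.mpr ⟨h1 x, h2 x⟩)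
    have hbound : ∀ x, |w (p x) * inner ℝ a (ξ x)|
        ≤ c * (M₁ + M₂) + ((c • (G₁ + G₂)).payoff x).toReal := by
      intro x
      rw [hGe, abs_mul]
      have e1 : |w (p x)| ≤ ‖w‖ := w.norm_coe_le_norm _
      have e2 : |inner ℝ a (ξ x)| ≤ ‖a‖ * ‖ξ x‖ := abs_real_inner_le_norm _ _
      have e3 : ‖ξ x‖ ≤ (M₁ + (G₁.payoff x).toReal) + (M₂ + (G₂.payoff x).toReal) :=
        (norm_sub_le _ _).trans (add_le_add (h1b x) (h2b x))
      have e4 : |w (p x)| * |inner ℝ a (ξ x)| ≤ ‖w‖ * (‖a‖ * ‖ξ x‖) := by gcongr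
      have e5 : (c : ℝ) * ‖ξ x‖
          ≤ c * ((M₁ + (G₁.payoff x).toReal) + (M₂ + (G₂.payoff x).toReal)) := by gcongr
      have e6 : (c : ℝ) = ‖w‖ * ‖a‖ := by simp [hc]
      calc _ ≤ ‖w‖ * (‖a‖ * ‖ξ x‖) := e4
        _ = c * ‖ξ x‖ := by rw [e6]; ring
        _ ≤ _ := e5
        _ = _ := by ring
    have hfc : Continuous fun x => w (p x) * inner ℝ a (ξ x) :=
      (w.continuous.comp hpc).mul (continuous_const.inner hξc)
    have hfd := mem_dominatedSpace_of_abs_le _ _ hbound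
    have hgain : IsGain X s₀ fun x => w (p x) * inner ℝ a (ξ x) := by
      have := IsGain.single (s₀ := s₀) n hn (fun x => w (p x) • a) (by
        change Measurable[priceFiltration X s₀ ⟨n, hn'⟩] _
        rw [hF]
        exact ((w.continuous.measurable.comp (comap_measurable p)).smul_const a))
      simpa only [real_inner_smul_left] using this
    refine (hL.nonneg_of_gain ⟨_, hfd⟩ hgain).trans
      (hL.le_integral_add hμ hint ⟨_, hfd⟩ (C := c * (M₁ + M₂))
        (u := fun x => w (p x) * inner ℝ a (ξ x) - ((c • (G₁ + G₂)).payoff x).toReal)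
        ?_ (fun x => ?_) (c • (G₁ + G₂)) hGt fun x => by simp)
    · refine (hfc.sub ?_).upperSemicontinuous
      simp_rw [hGe]
      exact (h1c.add h2c).const_mul _
    · linarith [le_abs_self (w (p x) * inner ℝ a (ξ x)), hbound x]
  rw [hF] at hA
  obtain ⟨B, hB, rfl⟩ := hA
  refine ext_inner_left ℝ fun a => ?_
  rw [inner_zero_right, ← integral_inner hξi.integrableOn]
  refine setIntegral_preimage_eq_zero hpc.measurable (continuous_const.inner hξc).measurable
    (hξi.const_inner a) (fun w => le_antisymm ?_ (key w a)) hB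
  -- Reversing the direction `a` turns the inequality into an equality.
  have := key w (-a)
  simp only [inner_neg_left, mul_neg, integral_neg] at this
  linarith

theorem martingale_price (hmoment : ∀ n, Integrable (fun y : X n => ‖(y : Vec d)‖) (ν n))
    (hL : IsPricing s₀ L) {μ : Measure (PathSpace X)} (hμ : μ ∈ couplings X ν)
    (hint : ∀ (u : dominatedSpace X ν) (C : ℝ),
      UpperSemicontinuous (u : PathSpace X → ℝ) → (∀ x, (u : PathSpace X → ℝ) x ≤ C) →
        L u ≤ ∫ x, (u : PathSpace X → ℝ) x ∂μ) :
    Martingale (price X s₀) (priceFiltration X s₀) μ := by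
  have := hμ.1
  have hS : ∀ t, Integrable (price X s₀ t) μ := by
    intro t
    obtain ⟨M, G, -, -, h⟩ := exists_norm_price_le (s₀ := s₀) hmoment t
    exact ((integrable_const M).add (G.integrable_payoff hμ)).mono'
      (measurable_price X s₀ t).aestronglyMeasurable (ae_of_all _ h)
  refine ⟨fun t => (measurable_price_filtration X s₀ le_rfl).stronglyMeasurable, ?_⟩
  rintro ⟨i, hi⟩ ⟨k, hk⟩ hik
  have hik' : i ≤ k := hik
  refine (ae_eq_condExp_of_forall_setIntegral_eq ((priceFiltration X s₀).le _) (hS _)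
    (fun _ _ _ => (hS _).integrableOn) (fun A hA _ => ?_)
    (measurable_price_filtration X s₀ le_rfl).stronglyMeasurable.aestronglyMeasurable).symm
  clear hik
  induction k, hik' using Nat.le_induction with
  | base => rfl
  | succ k hik ih =>
    have hk' : (k : ℕ∞) ≤ T := le_trans (Nat.cast_le.mpr (Nat.le_succ k)) hk
    rw [ih hk', eq_comm, ← sub_eq_zero, ← integral_sub (hS _).integrableOn (hS _).integrableOn]
    exact hL.setIntegral_increment_eq_zero hmoment hμ hint k hk hk' hS
      ((priceFiltration X s₀).mono (Subtype.mk_le_mk.mpr hik) _ hA)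

end IsPricing

/-- Attainment of the superhedging price by a martingale measure. -/
theorem exists_martingaleMeasure_hedgeCosts_le (hX : ∀ n, IsClosed (X n))
    (hprob : ∀ n, IsProbabilityMeasure (ν n))
    (hmoment : ∀ n, Integrable (fun y : X n => ‖(y : Vec d)‖) (ν n))
    (hna : ¬ ∃ θ : SemiStatic X ν s₀, θ.IsUniformArbitrage) {f u : PathSpace X → ℝ}
    (hfd : f ∈ dominatedSpace X ν) (hu : UpperSemicontinuous u) {C : ℝ} (hC : ∀ x, u x ≤ C)
    (G : OptionPortfolio X ν) (hG : ∀ x, G.payoff x ≠ ∞)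
    (hf : ∀ x, f x = u x + (G.payoff x).toReal) :
    ∃ μ ∈ martingaleMeasures X ν s₀, sInf (hedgeCosts X ν s₀ f) ≤ ∫ x, f x ∂μ := by
  obtain ⟨L, hL0, hL⟩ := exists_linear_le_hedgeCosts hna ⟨f, hfd⟩
  change IsPricing s₀ L at hL
  obtain ⟨μ, hμ, hint⟩ := hL.exists_coupling hX
  exact ⟨μ, ⟨hμ, hL.martingale_price hmoment hμ hint⟩,
    hL0.symm.trans_le (hL.le_integral_add hμ hint ⟨f, hfd⟩ hu hC G hG hf)⟩

end Duality

end MartTransport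

end
-- The equivalence and the duality theorem.
theorem mainTheorem3 {d : ℕ} {T : ℕ∞}
    (X : MartTransport.Period T → Set (MartTransport.Vec d)) (hX : ∀ n, IsClosed (X n))
    (s₀ : MartTransport.Vec d)
    (ν : ∀ n, Measure (X n)) (hprob : ∀ n, IsProbabilityMeasure (ν n))
    (hmoment : ∀ n, Integrable (fun y : X n => ‖(y : MartTransport.Vec d)‖) (ν n)) :
    [¬ ∃ θ : MartTransport.SemiStatic X ν s₀, θ.IsModelIndependentArbitrage,
     ¬ ∃ θ : MartTransport.SemiStatic X ν s₀, θ.IsUniformArbitrage,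
     (MartTransport.martingaleMeasures X ν s₀).Nonempty].TFAE ∧
    ((MartTransport.martingaleMeasures X ν s₀).Nonempty →
      ∀ f ∈ MartTransport.dominatedFunctions X ν ∩ MartTransport.uscAddOptions X ν,
        (∀ μ ∈ MartTransport.martingaleMeasures X ν s₀, Integrable f μ) ∧
        IsGreatest ((fun μ => ((∫ x, f x ∂μ : ℝ) : EReal)) ''
            MartTransport.martingaleMeasures X ν s₀)
          (MartTransport.superhedgingPrice X ν s₀ f)) := by
  open MartTransport in
  refine ⟨?_, fun hne f hf => ?_⟩
  · tfae_have 1 → 2 := not_isUniformArbitrage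
    -- Existence is the attainment statement for the zero claim.
    tfae_have 2 → 3 := fun h => by
      obtain ⟨μ, hμ, -⟩ := exists_martingaleMeasure_hedgeCosts_le hX hprob hmoment h (f := 0)
        (u := 0) (zero_mem _) upperSemicontinuous_const (C := 0) (fun x => le_rfl) 0
        (fun x => by simp [OptionPortfolio.payoff_zero])
        (fun x => by simp [OptionPortfolio.payoff_zero])
      exact ⟨μ, hμ⟩
    tfae_have 3 → 1 := not_isModelIndependentArbitrage
    tfae_finish
  · have hna := not_isUniformArbitrage (not_isModelIndependentArbitrage hne)
    obtain ⟨⟨hfm, _, ⟨G', rfl⟩, hG'⟩, u, ⟨hu, ⟨C, hC⟩, -⟩, _, ⟨G, rfl⟩, hG⟩ := hf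
    have hfd : f ∈ dominatedSpace X ν := ⟨0, G', fun x => by
      rw [Real.enorm_eq_ofReal_abs, ENNReal.coe_zero, zero_add]
      exact hG' x⟩
    have hi : ∀ μ ∈ martingaleMeasures X ν s₀, Integrable f μ := fun μ hμ =>
      integrable_of_mem_dominatedSpace hfd hfm hμ.1
    -- Since `f` is real-valued, the option part of its decomposition is finite everywhere.
    have hGt : ∀ x, G.payoff x ≠ ∞ := fun x h => by
      have := hG x
      simp [h] at this
    have hle : ∀ μ ∈ martingaleMeasures X ν s₀,
        ((∫ x, f x ∂μ : ℝ) : EReal) ≤ superhedgingPrice X ν s₀ f := by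
      rintro μ hμ
      refine le_sInf ?_
      rintro _ ⟨θ, hθ, rfl⟩
      exact EReal.coe_le_coe_iff.mpr (integral_le_of_mem_hedgeCosts hμ (hi μ hμ) ⟨θ, hθ, rfl⟩)
    obtain ⟨μ, hμ, hμle⟩ := exists_martingaleMeasure_hedgeCosts_le hX hprob hmoment hna hfd hu
      (fun x => (le_max_left _ _).trans (hC x)) G hGt fun x => by
        have := hG x
        rw [← EReal.coe_ennreal_toReal (hGt x)] at this
        exact_mod_cast this
    refine ⟨hi, ⟨μ, hμ, le_antisymm (hle μ hμ) ?_⟩, ?_⟩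
    -- A real number strictly inside the gap exceeds the real infimum of hedging costs, so some
    -- strategy would cost less than the extended-real infimum.
    · by_contra! hlt
      obtain ⟨r, h1, h2⟩ := EReal.lt_iff_exists_real_btwn.mp hlt
      obtain ⟨c, ⟨θ, hθ, rfl⟩, hcr⟩ := exists_lt_of_csInf_lt (hedgeCosts_nonempty hfd)
        (hμle.trans_lt (EReal.coe_lt_coe_iff.mp h1))
      have : superhedgingPrice X ν s₀ f ≤ (θ.cost : EReal) := sInf_le ⟨θ, hθ, rfl⟩
      exact absurd (h2.trans_le this) (not_lt.mpr (EReal.coe_le_coe_iff.mpr hcr.le))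
    · rintro _ ⟨μ', hμ', rfl⟩
      exact hle μ' hμ'
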